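/- Let $C_0^\infty(\mathbb R_+)$ be the space of complex-valued smooth functions with compact support in $(0,\infty)$, with its usual topology, and let $C_0^\infty(\mathbb R_+)'$ be its dual, the space of continuous antilinear functionals $h$, with pairing $\langle h,F\rangle=h(F)$. Let $\mathcal Y$ be the space of entire functions $\varphi$ for which there are $r_+<0$, $r_-\in\mathbb R$ and constants $C_n$ with $$|\varphi(\lambda)|\le C_n(1+|\lambda|)^{-n}e^{r_\pm|\operatorname{Re}\lambda|},\qquad \pm\operatorname{Re}\lambda\ge 0,\quad n=0,1,2,\dots$$ We say that $\varphi_k\to0$ in $\mathcal Y$ if these bounds hold for all $\varphi_k$ with the same $r_\pm$ and $C_n$, and $\varphi_k\to0$ uniformly on compact subsets of $\mathbb C$. Let $\mathcal Y'$ be the space of antilinear functionals on $\mathcal Y$ that are continuous for this convergence, with pairing $\langle\sigma,w\rangle=\sigma(w)$. Let $(\mathsf Lf)(\lambda)=\int_0^\infty e^{-t\lambda}f(t)\,dt$, which maps $C_0^\infty(\mathbb R_+)$ into $\mathcal Y$, and put $(\bar f\star f)(t)=\int_0^t\overline{f(s)}f(t-s)\,ds$ and $w^*(\lambda)=\overline{w(\bar\lambda)}$.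 For a complex number $z$, $z>0$ (or $z\ge0$) means that $z$ is real and $z>0$ (or $z\geq 0$). For a function $\mathsf q$ on a complex vector space $\mathsf D$, let $N_\pm(\mathsf q;\mathsf D)\in\{0,1,2,\dots,\infty\}$ be the supremum of the dimensions of the linear sets $\mathcal M\subset\mathsf D$ such that $\pm\mathsf q(\varphi)>0$ for all $\varphi\in\mathcal M$, $\varphi\ne0$. Theorem. Let $h\in C_0^\infty(\mathbb R_+)'$. Then there is exactly one $\sigma\in\mathcal Y'$ (the sigma-function $\sigma=(\mathsf L^*)^{-1}h$ of $h$) such that $\langle h,F\rangle=\langle\sigma,\mathsf LF\rangle$ for all $F\in C_0^\infty(\mathbb R_+)$. For the forms $h[f,f]=\langle h,\bar f\star f\rangle$ on $C_0^\infty(\mathbb R_+)$ and $\sigma[w,w]=\langle\sigma,w^*w\rangle$ on $\mathcal Y$, $$N_\pm(h;C_0^\infty(\mathbb R_+))=N_\pm(\sigma;\mathcal Y).$$ In particular, $\pm\langle h,\bar f\star f\rangle\ge0$ for all $f\in C_0^\infty(\mathbb R_+)$ if and only if $\pm\langle\sigma,w^*w\rangle\ge0$ for all $w\in\mathcal Y$.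 -/

import Mathlib

open Set Filter Topology MeasureTheory TopologicalSpace
open scoped Distributions ContDiff ComplexConjugate ComplexOrder

namespace HankelSigma

/-- The open half-line `(0, ∞)`. -/
def Rplus : Opens ℝ := ⟨Ioi 0, isOpen_Ioi⟩

/-- The dual space of `C₀^∞(ℝ₊)`: continuous antilinear functionals on the complex-valued
test functions on `(0, ∞)`, these carrying their canonical LF topology.
The duality pairing `⟨h, F⟩` is `h F`. -/
abbrev DDual : Type := 𝓓(Rplus, ℂ) →L⋆[ℂ] ℂ

/-- The bounds defining `𝒴`, with given exponents `rp = r₊`, `rm = r₋` and constants `C n`. -/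
def YBound (rp rm : ℝ) (C : ℕ → ℝ) (φ : ℂ → ℂ) : Prop :=
  ∀ (n : ℕ) (z : ℂ),
    (0 ≤ z.re → ‖φ z‖ ≤ C n * ((1 + ‖z‖) ^ n)⁻¹ * Real.exp (rp * |z.re|)) ∧
    (z.re ≤ 0 → ‖φ z‖ ≤ C n * ((1 + ‖z‖) ^ n)⁻¹ * Real.exp (rm * |z.re|))

lemma YBound.nonneg {rp rm : ℝ} {C : ℕ → ℝ} {φ : ℂ → ℂ} (h : YBound rp rm C φ) (n : ℕ) :
    0 ≤ C n := by
  have := (h n 0).1 le_rfl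
  simp at this
  exact (norm_nonneg _).trans this

lemma YBound.mono {rp rm rp' rm' : ℝ} {C : ℕ → ℝ} {φ : ℂ → ℂ} (h : YBound rp rm C φ)
    (h1 : rp ≤ rp') (h2 : rm ≤ rm') : YBound rp' rm' C φ := by
  intro n z
  have h0 : 0 ≤ C n * ((1 + ‖z‖) ^ n)⁻¹ := mul_nonneg (h.nonneg n) (by positivity)
  refine ⟨fun hz => ((h n z).1 hz).trans ?_, fun hz => ((h n z).2 hz).trans ?_⟩ <;> gcongr

/-- The space `𝒴` of test functions: entire functions satisfying the bounds `YBound` for all `n`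
with some `r₊ < 0` and some `r₋`. -/
def Y : Submodule ℂ (ℂ → ℂ) where
  carrier := {φ | Differentiable ℂ φ ∧ ∃ rp rm : ℝ, rp < 0 ∧ ∃ C : ℕ → ℝ, YBound rp rm C φ}
  zero_mem' := ⟨differentiable_const 0, -1, 0, by norm_num, 0, by intro n z; simp⟩
  add_mem' := by
    rintro φ ψ ⟨hφ, rp, rm, hrp, C, hC⟩ ⟨hψ, sp, sm, hsp, D, hD⟩
    refine ⟨hφ.add hψ, max rp sp, max rm sm, max_lt hrp hsp, C + D, ?_⟩
    have h1 := hC.mono (le_max_left rp sp) (le_max_left rm sm)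
    have h2 := hD.mono (le_max_right rp sp) (le_max_right rm sm)
    intro n z
    refine ⟨fun hz => ?_, fun hz => ?_⟩
    · have := add_le_add ((h1 n z).1 hz) ((h2 n z).1 hz)
      simp only [Pi.add_apply, add_mul]
      exact (norm_add_le _ _).trans this
    · have := add_le_add ((h1 n z).2 hz) ((h2 n z).2 hz)
      simp only [Pi.add_apply, add_mul]
      exact (norm_add_le _ _).trans this
  smul_mem' := by
    rintro c φ ⟨hφ, rp, rm, hrp, C, hC⟩
    refine ⟨hφ.const_smul c, rp, rm, hrp, fun n => ‖c‖ * C n, ?_⟩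
    intro n z
    refine ⟨fun hz => ?_, fun hz => ?_⟩
    · have := mul_le_mul_of_nonneg_left ((hC n z).1 hz) (norm_nonneg c)
      simpa [mul_assoc] using this
    · have := mul_le_mul_of_nonneg_left ((hC n z).2 hz) (norm_nonneg c)
      simpa [mul_assoc] using this

/-- Convergence `φ k → 0` in `𝒴`: the bounds hold with common `r₊ < 0`, `r₋` and `C n`, and
`φ k → 0` uniformly on compact subsets of `ℂ`. -/
def TendstoZeroInY (φ : ℕ → Y) : Prop :=
  (∃ rp rm : ℝ, rp < 0 ∧ ∃ C : ℕ → ℝ, ∀ k, YBound rp rm C (φ k : ℂ → ℂ)) ∧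
    ∀ K : Set ℂ, IsCompact K → TendstoUniformlyOn (fun k z => (φ k : ℂ → ℂ) z) 0 atTop K

/-- The dual space `𝒴'`: antilinear functionals on `𝒴`, continuous for the above convergence.
The duality pairing `⟨σ, w⟩` is `σ.toLinearMap w`. -/
structure YDual where
  toLinearMap : Y →ₗ⋆[ℂ] ℂ
  continuous' : ∀ φ : ℕ → Y, TendstoZeroInY φ →
    Tendsto (fun k => toLinearMap (φ k)) atTop (𝓝 0)

/-- `w* w ∈ 𝒴` for `w ∈ 𝒴`, where `w*(z)` is the conjugate of `w (conj z)`. -/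
lemma starMul_mem (w : Y) : (fun z : ℂ => conj ((w : ℂ → ℂ) (conj z)) * (w : ℂ → ℂ) z) ∈ Y := by
  obtain ⟨w, hw, rp, rm, hrp, C, hC⟩ := w
  refine ⟨fun z => DifferentiableAt.mul ?_ (hw z), rp + rp, rm + rm, by linarith,
    fun n => C 0 * C n, ?_⟩
  · have := (hw (conj z)).conj_conj
    simpa [Function.comp_def] using this
  · intro n z
    refine ⟨fun hz => ?_, fun hz => ?_⟩
    · have a := (hC 0 (conj z)).1 (by simpa using hz)
      have b := (hC n z).1 hz
      simp only [norm_mul, RCLike.norm_conj]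
      refine (mul_le_mul a b (norm_nonneg _) ((norm_nonneg _).trans a)).trans (le_of_eq ?_)
      simp only [Complex.conj_re, pow_zero, inv_one, add_mul, Real.exp_add]
      ring
    · have a := (hC 0 (conj z)).2 (by simpa using hz)
      have b := (hC n z).2 hz
      simp only [norm_mul, RCLike.norm_conj]
      refine (mul_le_mul a b (norm_nonneg _) ((norm_nonneg _).trans a)).trans (le_of_eq ?_)
      simp only [Complex.conj_re, pow_zero, inv_one, add_mul, Real.exp_add]
      ring

/-- The element `w* w` of `𝒴`. -/
def starMul (w : Y) : Y := ⟨fun z : ℂ => conj ((w : ℂ → ℂ) (conj z)) * (w : ℂ → ℂ) z, starMul_mem w⟩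

/-- The Laplace transform `(L f)(z) = ∫₀^∞ e^{-t z} f(t) dt`. -/
noncomputable def laplaceFun (f : ℝ → ℂ) (z : ℂ) : ℂ :=
  ∫ t in Ioi (0 : ℝ), Complex.exp (-(t * z)) * f t

section aux

lemma laplaceFun_eq (f : ℝ → ℂ) (hs : tsupport f ⊆ Ioi 0) (z : ℂ) :
    laplaceFun f z = ∫ t : ℝ, Complex.exp (-(t * z)) * f t := by
  refine setIntegral_eq_integral_of_forall_compl_eq_zero fun t ht => ?_
  rw [image_eq_zero_of_notMem_tsupport (fun h => ht (hs h)), mul_zero]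

lemma laplace_differentiable (f : ℝ → ℂ) (hf : Continuous f) (hc : HasCompactSupport f)
    (hs : tsupport f ⊆ Ioi 0) : Differentiable ℂ (laplaceFun f) := by
  have he : laplaceFun f = fun z => ∫ t : ℝ, Complex.exp (-(t * z)) * f t :=
    funext (laplaceFun_eq f hs)
  rw [he]
  intro z₀
  refine (hasDerivAt_integral_of_dominated_loc_of_deriv_le
    (F' := fun z t => Complex.exp (-(t * z)) * (-(t : ℂ)) * f t)
    (bound := fun t => Real.exp (|t| * (‖z₀‖ + 1)) * |t| * ‖f t‖)
    (Metric.ball_mem_nhds z₀ one_pos) ?_ ?_ ?_ ?_ ?_ ?_).2.differentiableAt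
  · exact Eventually.of_forall fun z => (by fun_prop : Continuous _).aestronglyMeasurable
  · exact (by fun_prop : Continuous _).integrable_of_hasCompactSupport hc.mul_left
  · exact (by fun_prop : Continuous _).aestronglyMeasurable
  · refine Eventually.of_forall fun t z hz => ?_
    rw [norm_mul, norm_mul, Complex.norm_exp, norm_neg, Complex.norm_real, Real.norm_eq_abs]
    gcongr
    have h1 : ‖z‖ ≤ ‖z₀‖ + 1 := by
      have := norm_sub_norm_le z z₀
      rw [Metric.mem_ball, dist_eq_norm] at hz
      linarith
    calc (-((t : ℂ) * z)).re ≤ ‖-((t : ℂ) * z)‖ := Complex.re_le_norm _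
      _ = |t| * ‖z‖ := by simp
      _ ≤ _ := by gcongr
  · exact (by fun_prop : Continuous _).integrable_of_hasCompactSupport hc.norm.mul_left
  · refine Eventually.of_forall fun t z _ => ?_
    have : HasDerivAt (fun z : ℂ => -((t : ℂ) * z)) (-(t : ℂ)) z := by
      simpa using ((hasDerivAt_id z).const_mul (t : ℂ)).fun_neg
    exact (this.cexp).mul_const _

lemma laplace_deriv (f : ℝ → ℂ) (hf : ContDiff ℝ ∞ f) (hc : HasCompactSupport f)
    (hs : tsupport f ⊆ Ioi 0) (z : ℂ) : laplaceFun (deriv f) z = z * laplaceFun f z := by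
  rw [laplaceFun_eq f hs, laplaceFun_eq _ ((tsupport_deriv_subset (f := f)).trans hs)]
  have hd : Continuous (deriv f) := hf.continuous_deriv (by simp)
  have hf' := hf.continuous
  have key := integral_mul_deriv_eq_deriv_mul_of_integrable (A := ℂ)
    (u := fun t : ℝ => Complex.exp (-(t * z))) (v := f)
    (u' := fun t : ℝ => Complex.exp (-(t * z)) * (-z)) (v' := deriv f) ?_ ?_ ?_ ?_ ?_
  · rw [key, ← integral_neg, ← integral_const_mul]
    congr 1
    ext t
    ring
  · intro t _
    have : HasDerivAt (fun t : ℝ => -((t : ℂ) * z)) (-z) t := by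
      simpa using ((Complex.ofRealCLM.hasDerivAt (x := t)).mul_const z).fun_neg
    exact this.cexp
  · intro t _
    exact (hf.differentiable (by simp) t).hasDerivAt
  · exact (by fun_prop : Continuous _).integrable_of_hasCompactSupport hc.deriv.mul_left
  · exact (by fun_prop : Continuous _).integrable_of_hasCompactSupport hc.mul_left
  · exact (by fun_prop : Continuous _).integrable_of_hasCompactSupport hc.mul_left

lemma laplace_norm_le (f : ℝ → ℂ) (hf : Continuous f) (hc : HasCompactSupport f) {a b : ℝ}
    (ha : 0 < a) (hs : tsupport f ⊆ Icc a b) (z : ℂ) (M : ℝ)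
    (hM : ∀ t ∈ Icc a b, -(t * z.re) ≤ M) :
    ‖laplaceFun f z‖ ≤ (∫ t : ℝ, ‖f t‖) * Real.exp M := by
  rw [laplaceFun_eq f (hs.trans fun t ht => lt_of_lt_of_le ha ht.1), ← integral_mul_const]
  refine norm_integral_le_of_norm_le ?_ (Eventually.of_forall fun t => ?_)
  · exact (hf.norm.integrable_of_hasCompactSupport hc.norm).mul_const _
  · by_cases ht : t ∈ tsupport f
    · rw [norm_mul, Complex.norm_exp, mul_comm]
      gcongr
      simpa using hM t (hs ht)
    · simp [image_eq_zero_of_notMem_tsupport ht]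

lemma laplace_pow_le (a b : ℝ) (ha : 0 < a) (n : ℕ) : ∀ (f : ℝ → ℂ), ContDiff ℝ ∞ f →
    HasCompactSupport f → tsupport f ⊆ Icc a b → ∃ C : ℝ, 0 ≤ C ∧ ∀ (z : ℂ) (M : ℝ),
      (∀ t ∈ Icc a b, -(t * z.re) ≤ M) → ‖z‖ ^ n * ‖laplaceFun f z‖ ≤ C * Real.exp M := by
  induction n with
  | zero =>
    intro f hf hc hs
    refine ⟨∫ t : ℝ, ‖f t‖, integral_nonneg fun t => norm_nonneg _, fun z M hM => ?_⟩
    simpa using laplace_norm_le f hf.continuous hc ha hs z M hM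
  | succ n ih =>
    intro f hf hc hs
    obtain ⟨C, hC0, hC⟩ := ih (deriv f) (contDiff_infty_iff_deriv.1 hf).2 hc.deriv
      ((tsupport_deriv_subset (f := f)).trans hs)
    refine ⟨C, hC0, fun z M hM => ?_⟩
    have := hC z M hM
    rwa [laplace_deriv f hf hc (hs.trans fun t ht => lt_of_lt_of_le ha ht.1), norm_mul,
      ← mul_assoc, ← pow_succ] at this

lemma exists_Icc (K : Set ℝ) (hK : IsCompact K) (hs : K ⊆ Ioi 0) :
    ∃ a b : ℝ, 0 < a ∧ K ⊆ Icc a b := by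
  rcases K.eq_empty_or_nonempty with rfl | hne
  · exact ⟨1, 1, one_pos, empty_subset _⟩
  · exact ⟨sInf K, sSup K, hs (hK.sInf_mem hne),
      fun t ht => ⟨csInf_le hK.bddBelow ht, le_csSup hK.bddAbove ht⟩⟩

lemma laplace_mem (f : 𝓓(Rplus, ℂ)) : laplaceFun f ∈ Y := by
  have hf : ContDiff ℝ ∞ (f : ℝ → ℂ) := f.contDiff
  have hc := f.hasCompactSupport
  have hs : tsupport (f : ℝ → ℂ) ⊆ Ioi 0 := f.tsupport_subset
  obtain ⟨a, b, ha, hab⟩ := exists_Icc _ hc hs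
  refine ⟨laplace_differentiable f hf.continuous hc hs, -a, b, by linarith, ?_⟩
  choose C hC0 hC using fun n => laplace_pow_le a b ha n f hf hc hab
  refine ⟨fun n => 2 ^ n * (C 0 + C n), fun n z => ?_⟩
  have main : ∀ M : ℝ, (∀ t ∈ Icc a b, -(t * z.re) ≤ M) →
      ‖laplaceFun f z‖ ≤ 2 ^ n * (C 0 + C n) * ((1 + ‖z‖) ^ n)⁻¹ * Real.exp M := by
    intro M hM
    have h0 := hC 0 z M hM
    have h1 := hC n z M hM
    have hp : (0 : ℝ) < (1 + ‖z‖) ^ n := by positivity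
    rw [mul_right_comm, ← div_eq_mul_inv, le_div_iff₀ hp]
    have h2 : (1 + ‖z‖) ^ n ≤ 2 ^ n * (1 + ‖z‖ ^ n) := by
      calc (1 + ‖z‖) ^ n ≤ 2 ^ (n - 1) * (1 ^ n + ‖z‖ ^ n) :=
            add_pow_le zero_le_one (norm_nonneg _) n
        _ ≤ 2 ^ n * (1 ^ n + ‖z‖ ^ n) := by
            gcongr
            · norm_num
            · omega
        _ = _ := by rw [one_pow]
    calc ‖laplaceFun f z‖ * (1 + ‖z‖) ^ n
        ≤ ‖laplaceFun f z‖ * (2 ^ n * (1 + ‖z‖ ^ n)) := by gcongr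
      _ = 2 ^ n * (‖z‖ ^ 0 * ‖laplaceFun f z‖ + ‖z‖ ^ n * ‖laplaceFun f z‖) := by ring
      _ ≤ 2 ^ n * (C 0 * Real.exp M + C n * Real.exp M) := by gcongr
      _ = _ := by ring
  refine ⟨fun hz => main _ fun t ht => ?_, fun hz => main _ fun t ht => ?_⟩
  · rw [abs_of_nonneg hz]
    nlinarith [ht.1]
  · rw [abs_of_nonpos hz]
    nlinarith [ht.2]

end aux

/-- The Laplace transform as a map `L : C₀^∞(ℝ₊) → 𝒴`. -/
noncomputable def laplace (f : 𝓓(Rplus, ℂ)) : Y := ⟨laplaceFun f, laplace_mem f⟩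

/-- `σ` is the sigma-function of `h`: `L* σ = h`, that is,
`⟨h, F⟩ = ⟨σ, L F⟩` for all test functions `F`. -/
def IsSigmaFunction (h : DDual) (σ : YDual) : Prop :=
  ∀ F : 𝓓(Rplus, ℂ), h F = σ.toLinearMap (laplace F)

/-- The Laplace convolution `(f̄ ⋆ g)(t) = ∫₀ᵗ conj (f s) g(t - s) ds`. -/
noncomputable def laplaceConvFun (f g : ℝ → ℂ) (t : ℝ) : ℂ :=
  ∫ s in (0 : ℝ)..t, conj (f s) * g (t - s)

section aux

open scoped Convolution Pointwise

lemma laplaceConvFun_eq (f g : ℝ → ℂ) (hf : tsupport f ⊆ Ioi 0) (hg : tsupport g ⊆ Ioi 0) :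
    laplaceConvFun f g =
      (fun s => conj (f s)) ⋆[ContinuousLinearMap.mul ℝ ℂ, volume] g := by
  have f0 : ∀ s : ℝ, s ≤ 0 → f s = 0 := fun s hs =>
    image_eq_zero_of_notMem_tsupport fun h => absurd (hf h) (not_lt.2 hs)
  have g0 : ∀ s : ℝ, s ≤ 0 → g s = 0 := fun s hs =>
    image_eq_zero_of_notMem_tsupport fun h => absurd (hg h) (not_lt.2 hs)
  ext t
  rw [laplaceConvFun, convolution_def]
  simp only [ContinuousLinearMap.mul_apply']
  rcases le_total 0 t with ht | ht
  · rw [intervalIntegral.integral_of_le ht]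
    refine setIntegral_eq_integral_of_forall_compl_eq_zero fun s hs => ?_
    rcases le_or_gt s 0 with h | h
    · simp [f0 s h]
    · rw [g0 (t - s), mul_zero]
      by_contra h'
      exact hs ⟨h, by linarith⟩
  · have hz : ∀ s : ℝ, conj (f s) * g (t - s) = 0 := fun s => by
      rcases le_or_gt s 0 with h | h
      · simp [f0 s h]
      · rw [g0 (t - s) (by linarith), mul_zero]
    simp [hz]

lemma laplaceConv_tsupport (f g : 𝓓(Rplus, ℂ)) :
    HasCompactSupport (laplaceConvFun f g) ∧ tsupport (laplaceConvFun f g) ⊆ Ioi 0 := by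
  have hf : tsupport (f : ℝ → ℂ) ⊆ Ioi 0 := f.tsupport_subset
  have hg : tsupport (g : ℝ → ℂ) ⊆ Ioi 0 := g.tsupport_subset
  have hK : IsCompact (tsupport (f : ℝ → ℂ) + tsupport (g : ℝ → ℂ)) :=
    IsCompact.add f.hasCompactSupport g.hasCompactSupport
  have hsub : Function.support (laplaceConvFun f g) ⊆
      tsupport (f : ℝ → ℂ) + tsupport (g : ℝ → ℂ) := by
    rw [laplaceConvFun_eq f g hf hg]
    refine (support_convolution_subset _).trans (add_subset_add ?_ (subset_tsupport _))
    refine Subset.trans (fun s hs => ?_) (subset_tsupport _)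
    simpa using hs
  refine ⟨HasCompactSupport.of_support_subset_isCompact hK hsub,
    (closure_minimal hsub hK.isClosed).trans ?_⟩
  rintro _ ⟨s, hs, t, ht, rfl⟩
  exact add_pos (mem_Ioi.1 (hf hs)) (mem_Ioi.1 (hg ht))

lemma laplaceConv_contDiff (f g : 𝓓(Rplus, ℂ)) : ContDiff ℝ ∞ (laplaceConvFun f g) := by
  rw [laplaceConvFun_eq f g f.tsupport_subset g.tsupport_subset]
  refine g.hasCompactSupport.contDiff_convolution_right _ ?_ g.contDiff
  exact (Complex.continuous_conj.comp f.continuous).locallyIntegrable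

end aux

/-- The test function `f̄ ⋆ g`. -/
noncomputable def laplaceConv (f g : 𝓓(Rplus, ℂ)) : 𝓓(Rplus, ℂ) where
  toFun := laplaceConvFun f g
  contDiff' := laplaceConv_contDiff f g
  hasCompactSupport' := (laplaceConv_tsupport f g).1
  tsupport_subset' := (laplaceConv_tsupport f g).2

/-- The form `h[f, f] = ⟨h, f̄ ⋆ f⟩` on `C₀^∞(ℝ₊)`. -/
noncomputable def hankelForm (h : DDual) (f : 𝓓(Rplus, ℂ)) : ℂ := h (laplaceConv f f)

/-- The form `σ[w, w] = ⟨σ, w* w⟩` on `𝒴`. -/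
def sigmaForm (σ : YDual) (w : Y) : ℂ := σ.toLinearMap (starMul w)

/-- `N₊(q; D)`: the maximal dimension, in `{0, 1, 2, …, ∞}`, of linear sets `M ⊆ D` such that
`q φ > 0` for all `φ ∈ M`, `φ ≠ 0`. (The order on `ℂ` is the usual one: `0 < z` means that `z` is
real and strictly positive.) -/
noncomputable def Npos {D : Type*} [AddCommGroup D] [Module ℂ D] (q : D → ℂ) : ℕ∞ :=
  ⨆ M : {M : Submodule ℂ D // ∀ φ ∈ M, φ ≠ 0 → 0 < q φ}, Cardinal.toENat (Module.rank ℂ M.1)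

/-- `N₋(q; D) = N₊(-q; D)`. -/
noncomputable def Nneg {D : Type*} [AddCommGroup D] [Module ℂ D] (q : D → ℂ) : ℕ∞ :=
  Npos fun φ => -q φ

end HankelSigma

open HankelSigma

/-!
The Laplace transform `L` is a linear isomorphism of `C₀^∞(ℝ₊)` onto `𝒴` whose inverse is
sequentially continuous, and it turns `f̄ ⋆ f` into `(L f)* (L f)`. Hence `σ = h ∘ L⁻¹` is the only
sigma-function of `h`, and `h[f, f] = σ[L f, L f]`, so that the two forms have the same inertia and
are semidefinite simultaneously.

The isomorphism is a Paley–Wiener theorem. The inverse is defined by integration along the imaginary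
axis, `(L⁻¹ φ)(t) = ∫ e^{2π i t y} φ(2π i y) dy`, which is an inverse Fourier transform. The decay of
`φ` on the imaginary axis makes it smooth. Moving the line of integration to `+∞` or `-∞`
(`integral_imaginary_axis_eq_zero`) shows that it vanishes outside `[-r₊, r₋]`, a compact subset of
`(0, ∞)` because `r₊ < 0` (`YBound.support_invLaplace_subset`). Fourier inversion gives
`L (L⁻¹ φ) = φ` on the imaginary axis, and then on `ℂ` by the identity theorem
(`YBound.laplaceFun_invLaplace`); it also gives `L⁻¹ (L f) = f` (`invLaplace_laplaceFun`).

For continuity, the derivative of order `n` of `L⁻¹ φ` is bounded by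
`(2π)^n ∫ |y|^n |φ(2π i y)| dy`. Along a null sequence of `𝒴` these integrals tend to zero by
dominated convergence, while the supports stay in one compact set, so the inverse transforms tend to
zero in `C₀^∞(ℝ₊)` (`TendstoZeroInY.tendsto_laplaceEquiv_symm`).
-/

namespace HankelSigma

open Complex FourierTransform

/-! ### Moving vertical lines of integration -/

lemma integrable_vertical {H : ℂ → ℂ} (hH : Differentiable ℂ H) {c M : ℝ}
    (hM : ∀ y : ℝ, ‖H (c + y * I)‖ ≤ M * (1 + y ^ 2)⁻¹) :
    Integrable fun y : ℝ => H (c + y * I) := by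
  have hc := hH.continuous
  exact (integrable_inv_one_add_sq.const_mul M).mono'
    (by fun_prop : Continuous _).aestronglyMeasurable (Eventually.of_forall hM)

/-- Cauchy's theorem for a vertical strip: the integral of an entire function with quadratic decay
along a vertical line does not change when the line is moved within the strip. -/
lemma integral_vertical_shift {H : ℂ → ℂ} (hH : Differentiable ℂ H) {c M : ℝ} (hc : 0 ≤ c)
    (hM : ∀ z : ℂ, 0 ≤ z.re → z.re ≤ c → ‖H z‖ ≤ M * (1 + z.im ^ 2)⁻¹) :
    ∫ y : ℝ, H (y * I) = ∫ y : ℝ, H (c + y * I) := by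
  have h0 : Integrable fun y : ℝ => H (y * I) := by
    simpa using integrable_vertical hH (c := 0) (M := M) fun y => by
      simpa using hM (y * I) (by simp) (by simpa using hc)
  have h1 : Integrable fun y : ℝ => H (c + y * I) :=
    integrable_vertical hH fun y => by
      simpa using hM (c + y * I) (by simpa using hc) (by simp)
  have t0 := intervalIntegral_tendsto_integral h0 tendsto_neg_atTop_atBot tendsto_id
  have t1 := intervalIntegral_tendsto_integral h1 tendsto_neg_atTop_atBot tendsto_id
  -- The horizontal sides of the rectangle, at heights `s T = ± T`, do not contribute in the limit.
  have horiz : ∀ s : ℝ → ℝ, (∀ T, s T ^ 2 = T ^ 2) →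
      Tendsto (fun T : ℝ => ∫ x in (0 : ℝ)..c, H (x + s T * I)) atTop (𝓝 0) := by
    intro s hs
    refine squeeze_zero_norm (a := fun T : ℝ => M * (1 + T ^ 2)⁻¹ * |c - 0|) (fun T => ?_) ?_
    · refine intervalIntegral.norm_integral_le_of_norm_le_const fun x hx => ?_
      rw [uIoc_of_le hc] at hx
      simpa [hs] using hM (x + s T * I) (by simpa using hx.1.le) (by simpa using hx.2)
    · have : Tendsto (fun T : ℝ => (1 + T ^ 2)⁻¹) atTop (𝓝 0) :=
        tendsto_inv_atTop_zero.comp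
          (tendsto_atTop_add_const_left _ _ (tendsto_pow_atTop two_ne_zero))
      simpa using (this.const_mul M).mul_const |c - 0|
  have hm := horiz (fun T => -T) fun T => neg_sq T
  have hp := horiz (fun T => T) fun T => rfl
  have key := (hm.sub hp).add ((t1.const_mul I).sub (t0.const_mul I))
  have hz : ∀ T : ℝ,
      ((∫ x in (0 : ℝ)..c, H (x + (-T : ℝ) * I)) - ∫ x in (0 : ℝ)..c, H (x + T * I)) +
      (I * (∫ y in (-T)..(id T), H (c + y * I)) - I * ∫ y in (-T)..(id T), H (y * I)) = 0 := by
    intro T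
    have := integral_boundary_rect_eq_zero_of_differentiableOn H (-T * I) (c + T * I)
      hH.differentiableOn
    simp only [smul_eq_mul] at this
    simp at this
    rw [← this]
    simp
    ring
  simp_rw [hz] at key
  have := tendsto_nhds_unique key tendsto_const_nhds
  rw [sub_zero, zero_add, ← mul_sub] at this
  exact (sub_eq_zero.1 ((mul_eq_zero.1 this).resolve_left I_ne_zero)).symm

/-- If an entire function decays exponentially in the right half-plane, the line of integration can
be moved to `+∞`, so its integral along the imaginary axis vanishes. -/
lemma integral_imaginary_axis_eq_zero {H : ℂ → ℂ} (hH : Differentiable ℂ H) {κ M : ℝ} (hκ : κ < 0)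
    (hM : ∀ z : ℂ, 0 ≤ z.re → ‖H z‖ ≤ M * (1 + z.im ^ 2)⁻¹ * Real.exp (κ * z.re)) :
    ∫ y : ℝ, H (y * I) = 0 := by
  have hM0 : 0 ≤ M := by
    have := (norm_nonneg _).trans (hM 0 le_rfl)
    simpa using this
  have hle : ∀ c : ℝ, 0 ≤ c → ‖∫ y : ℝ, H (y * I)‖ ≤ Real.exp (κ * c) * (M * Real.pi) := by
    intro c hc
    rw [integral_vertical_shift hH hc (M := M)]
    · have hi := integrable_inv_one_add_sq.const_mul (Real.exp (κ * c) * M)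
      calc _ ≤ ∫ y : ℝ, Real.exp (κ * c) * M * (1 + y ^ 2)⁻¹ := by
            refine norm_integral_le_of_norm_le hi (Eventually.of_forall fun y => ?_)
            refine (hM (c + y * I) (by simpa using hc)).trans (le_of_eq ?_)
            simp
            ring
        _ = _ := by
            rw [integral_const_mul, integral_univ_inv_one_add_sq]
            ring
    · intro z hz _
      refine (hM z hz).trans (mul_le_of_le_one_right (by positivity) ?_)
      exact Real.exp_le_one_iff.2 (mul_nonpos_of_nonpos_of_nonneg hκ.le hz)
  have hlim : Tendsto (fun c : ℝ => Real.exp (κ * c) * (M * Real.pi)) atTop (𝓝 0) := by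
    have : Tendsto (fun c : ℝ => Real.exp (κ * c)) atTop (𝓝 0) :=
      Real.tendsto_exp_atBot.comp (tendsto_id.const_mul_atTop_of_neg hκ)
    simpa using this.mul_const (M * Real.pi)
  exact norm_le_zero_iff.1 (ge_of_tendsto hlim ((eventually_ge_atTop 0).mono hle))

/-! ### The inverse Laplace transform and the Paley–Wiener theorem -/

/-- The restriction of `φ` to the imaginary axis, in the normalization of Mathlib's Fourier
transform: `axis φ y = φ (2π i y)`. -/
noncomputable def axis (φ : ℂ → ℂ) (y : ℝ) : ℂ := φ (2 * Real.pi * (y * I))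

/-- The inverse Laplace transform
`t ↦ ∫ e^{2π i t y} φ(2π i y) dy = (2π i)⁻¹ ∫_{iℝ} e^{t z} φ(z) dz`. -/
noncomputable def invLaplace (φ : ℂ → ℂ) : ℝ → ℂ := 𝓕⁻ (axis φ)

lemma invLaplace_eq_integral (φ : ℂ → ℂ) (t : ℝ) :
    invLaplace φ t = ∫ y : ℝ, exp (t * (2 * Real.pi * (y * I))) * φ (2 * Real.pi * (y * I)) := by
  rw [invLaplace, Real.fourierInv_eq']
  refine integral_congr_ae (Eventually.of_forall fun y => ?_)
  simp only [axis, smul_eq_mul]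
  congr 2
  simp
  ring

lemma axis_eq_fourier {f : ℝ → ℂ} (hs : tsupport f ⊆ Ioi 0) :
    axis (laplaceFun f) = 𝓕 f := by
  ext y
  rw [axis, laplaceFun_eq f hs, Real.fourier_eq']
  refine integral_congr_ae (Eventually.of_forall fun t => ?_)
  simp only [smul_eq_mul]
  congr 2
  simp
  ring

section bounds

variable {rp rm : ℝ} {C : ℕ → ℝ} {φ : ℂ → ℂ}

lemma inv_one_add_norm_le (n : ℕ) (z : ℂ) :
    ‖z‖ ^ n * ((1 + ‖2 * Real.pi * z‖) ^ (n + 2))⁻¹ ≤ (1 + z.im ^ 2)⁻¹ := by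
  have h1 : ‖z‖ ≤ ‖2 * Real.pi * z‖ := by
    rw [norm_mul, norm_mul, Complex.norm_real, Real.norm_of_nonneg Real.pi_pos.le]
    have := Real.pi_gt_three
    simp only [Complex.norm_ofNat]
    nlinarith [norm_nonneg z]
  have h2 : 1 + z.im ^ 2 ≤ (1 + ‖z‖) ^ 2 := by
    have := Complex.abs_im_le_norm z
    nlinarith [sq_abs z.im, abs_nonneg z.im]
  have h3 : ‖z‖ ^ n ≤ (1 + ‖z‖) ^ n := by gcongr; linarith
  rw [← div_eq_mul_inv, div_le_iff₀ (by positivity), inv_mul_eq_div, le_div_iff₀ (by positivity)]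
  calc ‖z‖ ^ n * (1 + z.im ^ 2) ≤ (1 + ‖z‖) ^ n * (1 + ‖z‖) ^ 2 := by gcongr
    _ = (1 + ‖z‖) ^ (n + 2) := (pow_add _ _ _).symm
    _ ≤ _ := by gcongr

lemma YBound.axis_le (hC : YBound rp rm C φ) (n : ℕ) (y : ℝ) :
    |y| ^ n * ‖axis φ y‖ ≤ C (n + 2) * (1 + y ^ 2)⁻¹ := by
  have h := (hC (n + 2) (2 * Real.pi * (y * I))).1 (by simp)
  have h0 := inv_one_add_norm_le n (y * I)
  have hC0 := hC.nonneg (n + 2)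
  have e : (2 * (Real.pi : ℂ) * (y * I)).re = 0 := by simp
  rw [e, abs_zero, mul_zero, Real.exp_zero, mul_one] at h
  have e1 : ‖(y : ℂ) * I‖ = |y| := by simp
  have e2 : ((y : ℂ) * I).im = y := by simp
  rw [e1, e2] at h0
  calc |y| ^ n * ‖axis φ y‖
      ≤ |y| ^ n * (C (n + 2) * ((1 + ‖2 * (Real.pi : ℂ) * (y * I)‖) ^ (n + 2))⁻¹) := by
        gcongr; exact h
    _ = C (n + 2) * (|y| ^ n * ((1 + ‖2 * (Real.pi : ℂ) * (y * I)‖) ^ (n + 2))⁻¹) := by ring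
    _ ≤ _ := by gcongr

lemma axis_continuous (hφ : Differentiable ℂ φ) : Continuous (axis φ) := by
  have := hφ.continuous
  unfold axis
  fun_prop

lemma YBound.integrable_pow_mul_axis (hφ : Differentiable ℂ φ) (hC : YBound rp rm C φ) (n : ℕ) :
    Integrable fun y : ℝ => |y| ^ n * ‖axis φ y‖ := by
  have := axis_continuous hφ
  refine (integrable_inv_one_add_sq.const_mul (C (n + 2))).mono'
    (by fun_prop : Continuous _).aestronglyMeasurable (Eventually.of_forall fun y => ?_)
  rw [Real.norm_of_nonneg (by positivity)]
  exact hC.axis_le n y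

lemma YBound.integrable_axis (hφ : Differentiable ℂ φ) (hC : YBound rp rm C φ) :
    Integrable (axis φ) := by
  rw [← integrable_norm_iff (axis_continuous hφ).aestronglyMeasurable]
  simpa using hC.integrable_pow_mul_axis hφ 0

/-- The inverse Laplace transform vanishes to the left of `-r₊` (move the contour to `+∞`) and to
the right of `r₋` (move it to `-∞`). -/
lemma YBound.support_invLaplace_subset (hφ : Differentiable ℂ φ) (hC : YBound rp rm C φ) :
    Function.support (invLaplace φ) ⊆ Icc (-rp) rm := by
  have hpi := Real.pi_pos
  have hC0 := hC.nonneg 2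
  have hre : ∀ z : ℂ, (2 * (Real.pi : ℂ) * z).re = 2 * Real.pi * z.re := fun z => by simp
  have hb : ∀ z : ℂ, C 2 * ((1 + ‖2 * (Real.pi : ℂ) * z‖) ^ 2)⁻¹ ≤ C 2 * (1 + z.im ^ 2)⁻¹ :=
    fun z => mul_le_mul_of_nonneg_left
      (by simpa only [pow_zero, one_mul, zero_add] using inv_one_add_norm_le 0 z) hC0
  intro t ht
  by_contra hmem
  refine ht ?_
  rw [invLaplace_eq_integral]
  rw [mem_Icc, not_and_or, not_le, not_le] at hmem
  rcases hmem with h | h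
  · refine integral_imaginary_axis_eq_zero
      (H := fun z => exp (t * (2 * Real.pi * z)) * φ (2 * Real.pi * z))
      (κ := 2 * Real.pi * (t + rp)) (M := C 2) (by fun_prop) (by nlinarith) fun z hz => ?_
    have h1 := (hC 2 (2 * Real.pi * z)).1 (by rw [hre]; positivity)
    rw [hre, abs_of_nonneg (by positivity)] at h1
    rw [norm_mul, norm_exp, re_ofReal_mul, hre]
    calc _ ≤ Real.exp (t * (2 * Real.pi * z.re)) * (C 2 * (1 + z.im ^ 2)⁻¹ *
          Real.exp (rp * (2 * Real.pi * z.re))) := by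
          gcongr
          exact h1.trans (mul_le_mul_of_nonneg_right (hb z) (Real.exp_nonneg _))
      _ = C 2 * (1 + z.im ^ 2)⁻¹ *
          (Real.exp (t * (2 * Real.pi * z.re)) * Real.exp (rp * (2 * Real.pi * z.re))) := by ring
      _ = _ := by rw [← Real.exp_add]; ring_nf
  · -- The reflection `z ↦ -z` exchanges the half-planes.
    rw [← integral_neg_eq_self]
    have := integral_imaginary_axis_eq_zero
      (H := fun z => exp (t * (2 * Real.pi * -z)) * φ (2 * Real.pi * -z))
      (κ := 2 * Real.pi * (rm - t))
      (M := C 2) (by fun_prop) (by nlinarith) fun z hz => ?_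
    · simpa using this
    have hle : (2 * (Real.pi : ℂ) * -z).re ≤ 0 := by
      rw [hre, neg_re]; nlinarith
    have h1 := (hC 2 (2 * Real.pi * -z)).2 hle
    rw [abs_of_nonpos hle, hre, neg_re] at h1
    rw [norm_mul, norm_exp, re_ofReal_mul, hre, neg_re]
    have hb' := hb (-z)
    rw [neg_im, neg_sq] at hb'
    calc _ ≤ Real.exp (t * (2 * Real.pi * -z.re)) * (C 2 * (1 + z.im ^ 2)⁻¹ *
          Real.exp (rm * -(2 * Real.pi * -z.re))) := by
          gcongr
          exact h1.trans (mul_le_mul_of_nonneg_right hb' (Real.exp_nonneg _))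
      _ = C 2 * (1 + z.im ^ 2)⁻¹ * (Real.exp (t * (2 * Real.pi * -z.re)) *
          Real.exp (rm * -(2 * Real.pi * -z.re))) := by ring
      _ = _ := by rw [← Real.exp_add]; ring_nf

lemma invLaplace_eq_fourier (φ : ℂ → ℂ) : invLaplace φ = 𝓕 fun y => axis φ (-y) :=
  Real.fourierInv_eq_fourier_comp_neg _

lemma YBound.contDiff_invLaplace (hφ : Differentiable ℂ φ) (hC : YBound rp rm C φ) :
    ContDiff ℝ ∞ (invLaplace φ) := by
  rw [invLaplace_eq_fourier]
  refine Real.contDiff_fourier fun n _ => ?_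
  simpa using (hC.integrable_pow_mul_axis hφ n).comp_neg

lemma YBound.norm_iteratedFDeriv_invLaplace_le (hφ : Differentiable ℂ φ) (hC : YBound rp rm C φ)
    (n : ℕ) (t : ℝ) :
    ‖iteratedFDeriv ℝ n (invLaplace φ) t‖ ≤
      (2 * Real.pi) ^ n * ∫ y : ℝ, |y| ^ n * ‖axis φ y‖ := by
  have hcont := axis_continuous hφ
  rw [norm_iteratedFDeriv_eq_norm_iteratedDeriv, invLaplace_eq_fourier,
    Real.iteratedDeriv_fourier (N := ⊤) _ le_top]
  · rw [Real.fourier_eq]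
    refine (norm_integral_le_integral_norm _).trans (le_of_eq ?_)
    rw [← integral_const_mul, ← integral_neg_eq_self]
    refine integral_congr_ae (Eventually.of_forall fun y => ?_)
    simp only [Circle.norm_smul, norm_smul, norm_pow, norm_mul, neg_neg, norm_neg,
      Complex.norm_real, Complex.norm_I, Real.norm_eq_abs, abs_of_pos Real.pi_pos,
      Complex.norm_ofNat, one_pow, one_mul, mul_pow, mul_assoc]
  · intro m _
    rw [← integrable_norm_iff (by fun_prop : Continuous _).aestronglyMeasurable]
    simpa [norm_smul] using (hC.integrable_pow_mul_axis hφ m).comp_neg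

lemma YBound.hasCompactSupport_invLaplace (hφ : Differentiable ℂ φ) (hC : YBound rp rm C φ) :
    HasCompactSupport (invLaplace φ) :=
  HasCompactSupport.of_support_subset_isCompact isCompact_Icc (hC.support_invLaplace_subset hφ)

lemma YBound.tsupport_invLaplace_subset (hφ : Differentiable ℂ φ) (hC : YBound rp rm C φ)
    (hrp : rp < 0) : tsupport (invLaplace φ) ⊆ Ioi 0 :=
  (closure_minimal (hC.support_invLaplace_subset hφ) isClosed_Icc).trans
    fun _ ht => (neg_pos.2 hrp).trans_le ht.1

/-- Fourier inversion gives `L (L⁻¹ φ) = φ` on the imaginary axis, and the identity theorem extends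
this to `ℂ`. -/
lemma YBound.laplaceFun_invLaplace (hφ : Differentiable ℂ φ) (hC : YBound rp rm C φ)
    (hrp : rp < 0) : laplaceFun (invLaplace φ) = φ := by
  have hcont := (hC.contDiff_invLaplace hφ).continuous
  have hcs := hC.hasCompactSupport_invLaplace hφ
  have hts := hC.tsupport_invLaplace_subset hφ hrp
  have haxis : axis (laplaceFun (invLaplace φ)) = axis φ := by
    rw [axis_eq_fourier hts, invLaplace]
    refine (axis_continuous hφ).fourier_fourierInv_eq (hC.integrable_axis hφ) ?_
    -- `𝓕 (axis φ)` is the reflection of `𝓕⁻ (axis φ)`, which is continuous with compact support.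
    have : Integrable (fun y => invLaplace φ (-y)) :=
      (hcont.integrable_of_hasCompactSupport hcs).comp_neg
    refine this.congr (Eventually.of_forall fun y => ?_)
    simp only [invLaplace, Real.fourierInv_eq_fourier_neg, neg_neg]
  have h1 : AnalyticOnNhd ℂ (laplaceFun (invLaplace φ)) univ := fun z _ =>
    (laplace_differentiable _ hcont hcs hts).analyticAt z
  have h2 : AnalyticOnNhd ℂ φ univ := fun z _ => hφ.analyticAt z
  refine h1.eq_of_frequently_eq h2 (z₀ := 0) ?_
  have hlim : Tendsto (fun y : ℝ => 2 * (Real.pi : ℂ) * (y * I)) (𝓝[≠] 0) (𝓝[≠] 0) := by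
    refine tendsto_nhdsWithin_iff.2 ⟨?_, ?_⟩
    · refine Tendsto.mono_left ?_ nhdsWithin_le_nhds
      exact (by fun_prop : Continuous fun y : ℝ => 2 * (Real.pi : ℂ) * (y * I)).tendsto' _ _
        (by simp)
    · filter_upwards [self_mem_nhdsWithin] with y hy
      have hy' : (y : ℂ) ≠ 0 := by exact_mod_cast hy
      simp [hy', Real.pi_ne_zero]
  exact hlim.frequently (Eventually.frequently (Eventually.of_forall fun y => congrFun haxis y))

end bounds

lemma invLaplace_laplaceFun (f : 𝓓(Rplus, ℂ)) : invLaplace (laplaceFun f) = f := by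
  have hs : tsupport (f : ℝ → ℂ) ⊆ Ioi 0 := f.tsupport_subset
  obtain ⟨hd, rp, rm, -, C, hC⟩ := laplace_mem f
  have hi := hC.integrable_axis hd
  rw [axis_eq_fourier hs] at hi
  rw [invLaplace, axis_eq_fourier hs]
  exact f.continuous.fourierInv_fourier_eq
    (f.continuous.integrable_of_hasCompactSupport f.hasCompactSupport) hi

/-! ### The Laplace transform as a linear isomorphism -/

lemma integrable_laplace_kernel (f : 𝓓(Rplus, ℂ)) (z : ℂ) :
    Integrable fun t : ℝ => exp (-(t * z)) * f t := by
  have := f.continuous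
  exact (by fun_prop : Continuous _).integrable_of_hasCompactSupport f.hasCompactSupport.mul_left

/-- The Laplace transform as a linear map. -/
noncomputable def laplaceLM : 𝓓(Rplus, ℂ) →ₗ[ℂ] Y where
  toFun := laplace
  map_add' f g := by
    ext z
    change laplaceFun _ z = laplaceFun f z + laplaceFun g z
    rw [laplaceFun_eq _ (f + g).tsupport_subset, laplaceFun_eq _ f.tsupport_subset,
      laplaceFun_eq _ g.tsupport_subset,
      ← integral_add (integrable_laplace_kernel f z) (integrable_laplace_kernel g z)]
    refine integral_congr_ae (Eventually.of_forall fun t => ?_)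
    simp [mul_add]
  map_smul' c f := by
    ext z
    change laplaceFun _ z = c * laplaceFun f z
    rw [laplaceFun_eq _ (c • f).tsupport_subset, laplaceFun_eq _ f.tsupport_subset,
      ← integral_const_mul]
    refine integral_congr_ae (Eventually.of_forall fun t => ?_)
    simp [mul_left_comm]

lemma laplaceLM_injective : Function.Injective laplaceLM := by
  intro f g hfg
  have h : laplaceFun f = laplaceFun g := congrArg Subtype.val hfg
  refine DFunLike.coe_injective ?_
  rw [← invLaplace_laplaceFun f, h, invLaplace_laplaceFun]

/-- The inverse Laplace transform of `φ ∈ 𝒴` as a test function supported in `[-r₊, r₋]`. -/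
noncomputable def YBound.invLaplaceOn {rp rm : ℝ} {C : ℕ → ℝ} {φ : ℂ → ℂ}
    (hφ : Differentiable ℂ φ) (hC : YBound rp rm C φ) :
    ContDiffMapSupportedIn ℝ ℂ ⊤ (⟨Icc (-rp) rm, isCompact_Icc⟩ : Compacts ℝ) :=
  .of_support_subset (hC.contDiff_invLaplace hφ) (hC.support_invLaplace_subset hφ)

lemma Icc_subset_Rplus {rp rm : ℝ} (hrp : rp < 0) :
    ((⟨Icc (-rp) rm, isCompact_Icc⟩ : Compacts ℝ) : Set ℝ) ⊆ Rplus :=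
  fun _ ht => (neg_pos.2 hrp).trans_le ht.1

lemma YBound.laplaceLM_invLaplaceOn {rp rm : ℝ} {C : ℕ → ℝ} (φ : Y)
    (hφ : Differentiable ℂ (φ : ℂ → ℂ)) (hC : YBound rp rm C (φ : ℂ → ℂ)) (hrp : rp < 0) :
    laplaceLM (TestFunction.ofSupportedIn (Icc_subset_Rplus hrp) (hC.invLaplaceOn hφ)) = φ :=
  Subtype.ext (hC.laplaceFun_invLaplace hφ hrp)

lemma laplaceLM_surjective : Function.Surjective laplaceLM := by
  intro φ
  obtain ⟨hd, rp, rm, hrp, C, hC⟩ := φ.2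
  exact ⟨_, hC.laplaceLM_invLaplaceOn φ hd hrp⟩

/-- The Paley–Wiener theorem: `L` is a linear isomorphism of `C₀^∞(ℝ₊)` onto `𝒴`. -/
noncomputable def laplaceEquiv : 𝓓(Rplus, ℂ) ≃ₗ[ℂ] Y :=
  LinearEquiv.ofBijective laplaceLM ⟨laplaceLM_injective, laplaceLM_surjective⟩

/-! ### Continuity of the inverse Laplace transform -/

/-- By dominated convergence, the moments on the imaginary axis of a null sequence in `𝒴` tend
to zero. -/
lemma TendstoZeroInY.tendsto_moment {φ : ℕ → Y} (h : TendstoZeroInY φ) (n : ℕ) :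
    Tendsto (fun k => ∫ y : ℝ, |y| ^ n * ‖axis (φ k : ℂ → ℂ) y‖) atTop (𝓝 0) := by
  obtain ⟨⟨rp, rm, hrp, C, hC⟩, hK⟩ := h
  have hlim : ∀ z : ℂ, Tendsto (fun k => (φ k : ℂ → ℂ) z) atTop (𝓝 0) := fun z =>
    (hK {z} isCompact_singleton).tendsto_at (mem_singleton z)
  have := tendsto_integral_of_dominated_convergence
    (F := fun k (y : ℝ) => |y| ^ n * ‖axis (φ k : ℂ → ℂ) y‖) (f := fun _ => (0 : ℝ))
    (μ := volume)
    (fun y : ℝ => C (n + 2) * (1 + y ^ 2)⁻¹) (fun k => ?_)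
    (integrable_inv_one_add_sq.const_mul _) (fun k => Eventually.of_forall fun y => ?_)
    (Eventually.of_forall fun y => ?_)
  · simpa using this
  · exact ((hC k).integrable_pow_mul_axis (φ k).2.1 n).aestronglyMeasurable
  · rw [Real.norm_of_nonneg (by positivity)]
    exact (hC k).axis_le n y
  · simpa [axis] using (hlim (2 * Real.pi * (y * I))).norm.const_mul (|y| ^ n)

lemma TendstoZeroInY.tendsto_laplaceEquiv_symm {φ : ℕ → Y} (h : TendstoZeroInY φ) :
    Tendsto (fun k => laplaceEquiv.symm (φ k)) atTop (𝓝 0) := by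
  have hmom := h.tendsto_moment
  obtain ⟨⟨rp, rm, hrp, C, hC⟩, -⟩ := h
  set F := fun k => (hC k).invLaplaceOn (φ k).2.1
  have hFφ : ∀ k, laplaceEquiv.symm (φ k) =
      TestFunction.ofSupportedIn (Icc_subset_Rplus hrp) (F k) := fun k => by
    rw [LinearEquiv.symm_apply_eq]
    exact ((hC k).laplaceLM_invLaplaceOn (φ k) (φ k).2.1 hrp).symm
  simp_rw [hFφ]
  refine ((TestFunction.continuous_ofSupportedIn (Icc_subset_Rplus hrp)).tendsto' 0 0 rfl).comp ?_
  refine ((ContDiffMapSupportedIn.withSeminorms ℝ ℝ ℂ ⊤ _).tendsto_nhds F 0).2 fun n ε hε => ?_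
  have hn := (hmom n).const_mul ((2 * Real.pi) ^ n)
  rw [mul_zero] at hn
  filter_upwards [hn.eventually_lt_const hε] with k hk
  rw [sub_zero]
  refine lt_of_le_of_lt ?_ hk
  refine (ContDiffMapSupportedIn.seminorm_top_le_iff ℝ ?_ n (F k)).2 fun t _ => ?_
  · have := Real.pi_pos
    exact mul_nonneg (by positivity) (integral_nonneg fun y => by positivity)
  · exact (hC k).norm_iteratedFDeriv_invLaplace_le (φ k).2.1 n t

/-- The sigma-function `(L*)⁻¹ h = h ∘ L⁻¹`. -/
noncomputable def sigmaFunction (h : DDual) : YDual where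
  toLinearMap := h.toLinearMap.comp (laplaceEquiv.symm : Y →ₗ[ℂ] 𝓓(Rplus, ℂ))
  continuous' φ hφ := by
    have := (h.continuous.tendsto' 0 0 (map_zero h)).comp hφ.tendsto_laplaceEquiv_symm
    exact this

lemma isSigmaFunction_sigmaFunction (h : DDual) : IsSigmaFunction h (sigmaFunction h) := by
  intro F
  change h F = h (laplaceEquiv.symm (laplaceEquiv F))
  rw [LinearEquiv.symm_apply_apply]

lemma IsSigmaFunction.unique {h : DDual} {σ τ : YDual} (hσ : IsSigmaFunction h σ)
    (hτ : IsSigmaFunction h τ) : σ = τ := by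
  obtain ⟨σ, _⟩ := σ
  obtain ⟨τ, _⟩ := τ
  congr 1
  ext w
  obtain ⟨F, rfl⟩ := laplaceEquiv.surjective w
  exact (hσ F).symm.trans (hτ F)

/-! ### The quadratic forms -/

/-- The convolution theorem: `L (f̄ ⋆ f) = (L f)* (L f)`. -/
lemma laplace_laplaceConv (f : 𝓓(Rplus, ℂ)) : laplace (laplaceConv f f) = starMul (laplace f) := by
  have hs : tsupport (f : ℝ → ℂ) ⊆ Ioi 0 := f.tsupport_subset
  ext z
  change laplaceFun (laplaceConvFun f f) z = conj (laplaceFun f (conj z)) * laplaceFun f z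
  have hconj : conj (laplaceFun f (conj z)) = ∫ t : ℝ, exp (-(t * z)) * conj (f t) := by
    rw [laplaceFun_eq f hs, ← integral_conj]
    refine integral_congr_ae (Eventually.of_forall fun t => ?_)
    simp [← exp_conj]
  have hi := integrable_laplace_kernel f z
  have hi' : Integrable fun t : ℝ => exp (-(t * z)) * conj (f t) := by
    rw [← integrable_norm_iff]
    · simpa using hi.norm
    · have := f.continuous
      exact (by fun_prop : Continuous _).aestronglyMeasurable
  rw [hconj, laplaceFun_eq _ (laplaceConv_tsupport f f).2, laplaceFun_eq f hs,
    ← ContinuousLinearMap.mul_apply' ℝ ℂ, ← integral_convolution _ hi' hi,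
    laplaceConvFun_eq f f hs hs]
  refine integral_congr_ae (Eventually.of_forall fun t => ?_)
  simp only [convolution_def, ContinuousLinearMap.mul_apply']
  rw [← integral_const_mul]
  refine integral_congr_ae (Eventually.of_forall fun s => ?_)
  have : exp (-((t : ℂ) * z)) = exp (-(s * z)) * exp (-((t - s : ℝ) * z)) := by
    rw [← exp_add]
    congr 1
    push_cast
    ring
  simp only [this]
  ring

lemma IsSigmaFunction.hankelForm_eq {h : DDual} {σ : YDual} (hσ : IsSigmaFunction h σ)
    (f : 𝓓(Rplus, ℂ)) : hankelForm h f = sigmaForm σ (laplaceEquiv f) := by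
  rw [hankelForm, hσ, laplace_laplaceConv]
  rfl

lemma Npos_le_of_linearEquiv {D E : Type*} [AddCommGroup D] [Module ℂ D] [AddCommGroup E]
    [Module ℂ E] (e : D ≃ₗ[ℂ] E) {q : D → ℂ} {q' : E → ℂ} (hq : ∀ x, q x = q' (e x)) :
    Npos q ≤ Npos q' := by
  refine iSup_le fun ⟨M, hM⟩ => ?_
  have hM' : ∀ φ ∈ M.map (e : D →ₗ[ℂ] E), φ ≠ 0 → 0 < q' φ := by
    rintro _ ⟨x, hx, rfl⟩ hne
    rw [LinearEquiv.coe_coe, ← hq]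
    exact hM x hx fun h0 => hne (by simp [h0])
  have hrank : Cardinal.toENat (Module.rank ℂ M) =
      Cardinal.toENat (Module.rank ℂ (M.map (e : D →ₗ[ℂ] E))) := by
    have := congrArg Cardinal.toENat (e.submoduleMap M).lift_rank_eq
    rwa [Cardinal.toENat_lift, Cardinal.toENat_lift] at this
  exact hrank.trans_le (le_iSup (fun M : {M : Submodule ℂ E // ∀ φ ∈ M, φ ≠ 0 → 0 < q' φ} =>
    Cardinal.toENat (Module.rank ℂ M.1)) ⟨_, hM'⟩)

lemma Npos_eq_of_linearEquiv {D E : Type*} [AddCommGroup D] [Module ℂ D] [AddCommGroup E]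
    [Module ℂ E] (e : D ≃ₗ[ℂ] E) {q : D → ℂ} {q' : E → ℂ} (hq : ∀ x, q x = q' (e x)) :
    Npos q = Npos q' :=
  (Npos_le_of_linearEquiv e hq).antisymm <| Npos_le_of_linearEquiv e.symm fun y => by
    rw [hq, e.apply_symm_apply]

end HankelSigma

theorem theorem2p5 (h : DDual) :
    (∃! σ : YDual, IsSigmaFunction h σ) ∧
    ∀ σ : YDual, IsSigmaFunction h σ →
      Npos (hankelForm h) = Npos (sigmaForm σ) ∧
      Nneg (hankelForm h) = Nneg (sigmaForm σ) ∧
      ((∀ f : 𝓓(Rplus, ℂ), 0 ≤ hankelForm h f) ↔ ∀ w : Y, 0 ≤ sigmaForm σ w) ∧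
      ((∀ f : 𝓓(Rplus, ℂ), 0 ≤ -hankelForm h f) ↔ ∀ w : Y, 0 ≤ -sigmaForm σ w) := by
  refine ⟨⟨sigmaFunction h, isSigmaFunction_sigmaFunction h, fun τ hτ =>
    hτ.unique (isSigmaFunction_sigmaFunction h)⟩, fun σ hσ => ?_⟩
  have hq := hσ.hankelForm_eq
  refine ⟨Npos_eq_of_linearEquiv laplaceEquiv hq,
    Npos_eq_of_linearEquiv laplaceEquiv fun f => by rw [hq], ?_, ?_⟩
  · simp_rw [hq]
    exact (laplaceEquiv.surjective.forall (p := fun w => 0 ≤ sigmaForm σ w)).symm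
  · simp_rw [hq]
    exact (laplaceEquiv.surjective.forall (p := fun w => 0 ≤ -sigmaForm σ w)).symm
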